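/- **Conventions.** Fix a linearly ordered set $\mathrm{PROP}$ of proposition symbols, a subset $\mathrm{PROP}_1\subseteq\mathrm{PROP}$ of distinguished symbols, and a linearly ordered set $\mathrm{VAR}$ of schema variables. Let $\Pi\subseteq\mathrm{PROP}$ be finite and $\Delta\in\mathbb N$. *Models.* A Kripke model over $\Pi$ is $M=(W,R,V)$ with $W\neq\emptyset$, $R\subseteq W\times W$, $V:\Pi\to\mathcal P(W)$. The local input of $w\in W$ is the bit string of truth values at $w$ of the symbols of $\Pi$ (in the order of $\mathrm{PROP}$); the identifier of $w$ is the bit string of truth values of the symbols of $\Pi\cap\mathrm{PROP}_1$. Let $\mathcal K(\Pi,\Delta)$ be the class of finite Kripke models over $\Pi$ in which distinct nodes have distinct identifiers and every node has at most $\Delta$ successors. The neighbours of $w$ are its successors, ordered lexicographically by identifier. *Programs.* Schemata are given by $\varphi::=\top\mid p\mid X\mid\neg\varphi\mid(\varphi\wedge\varphi)\mid\Diamond\varphi$ with $p\in\Pi$ and $X$ a schema variable. A $\Pi$-program $\Lambda$ of $\mathrm{MSC}$ consists of a finite nonempty set $\mathcal T\subseteq\mathrm{VAR}$ of head predicates,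 for each $Y\in\mathcal T$ a terminal clause $Y(0):=\varphi_Y$ (with $\varphi_Y$ free of variables) and an iteration clause $Y:=\psi_Y$ (with variables of $\psi_Y$ in $\mathcal T$), and sets $\mathcal A,\mathcal P\subseteq\mathcal T$ of attention and print predicates. Put $Y^0=\varphi_Y$, and let $Y^{n+1}$ be $\psi_Y$ with each $X\in\mathcal T$ replaced by $X^n$. In round $n$ the state of $\Lambda$ at $w$ is the string of the truth values of the formulas $Y^n$ at $w$ (ordered by $\mathrm{VAR}$). The size of $\Lambda$ is the number of occurrences of proposition symbols, head predicates and $\top,\neg,\wedge,\Diamond$ in its clauses; its modal depth is the maximum nesting depth of $\Diamond$ in the bodies of its clauses. *Circuits.* A Boolean circuit is a finite directed acyclic graph of gates: unlabeled input gates of fan-in $0$, gates labeled $\wedge$ or $\vee$ of any fan-in (fan-in $0$ giving $1$, respectively $0$), and gates labeled $\neg$ of fan-in $1$; the output gates are the gates of fan-out $0$; input and output gates are ordered. Its size is its number of gates. A message passing circuit ($\mathrm{MPC}$) for $(\Pi,\Delta)$ is a circuit computing a function $\{0,1\}^{|\Pi|+k(\Delta+1)}\to\{0,1\}^k$ for some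 $k\in\mathbb N$, together with sets $A,P\subseteq\{1,\dots,k\}$ of attention and print bits. On $M\in\mathcal K(\Pi,\Delta)$, the state of node $w$ in round $0$ is the output of the circuit on the local input of $w$ followed by $0^{k(\Delta+1)}$; its state in round $n+1$ is the output on the local input of $w$, followed by the round-$n$ state of $w$, the round-$n$ states of the neighbours of $w$ in order, and $0^k$ for each missing neighbour. *Output.* A program or circuit outputs at $w$ in round $n$ if $n$ is the first round in which some attention bit of the state at $w$ is $1$; the output is then the string of print bits of the round-$n$ state, and the computation time at $w$ is the number $n+1$ of rounds $0,\dots,n$. A $\Pi$-program and an $\mathrm{MPC}$ for $(\Pi,\Delta)$ are equivalent if at every node of every model in $\mathcal K(\Pi,\Delta)$ they produce the same output, or neither produces any output. **Theorem.** There are absolute constants $c_1,c_2$ such that for all $\Pi$ and $\Delta$ and every $\Pi$-program $\Lambda$ of $\mathrm{MSC}$ of size $m$ and modal depth $d$ there is an $\mathrm{MPC}$ $C$ for $(\Pi,\Delta)$, equivalent to $\Lambda$, of size at most $c_1(\max(1,\Delta)\,m+|\Pi|)$, such that at every node of every model in $\mathcal K(\Pi,\Delta)$ where they produce an output, the computation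 time of $C$ is at most $c_2\max(1,d)$ times the computation time of $\Lambda$. In particular, for $\Delta\ge 1$ the size of $C$ is $\mathcal O(\Delta m+|\Pi|)$. -/

import Mathlib

namespace MSC

/-! ### Modal formulas, schemata and Kripke models -/

/-- Schemata of modal substitution calculus over proposition symbols from `P` and schema
variables from `T`. -/
inductive Schema (P T : Type) : Type where
  | top : Schema P T
  | prop : P → Schema P T
  | var : T → Schema P T
  | neg : Schema P T → Schema P T
  | conj : Schema P T → Schema P T → Schema P T
  | dia : Schema P T → Schema P T

/-- Modal formulas are the schemata without schema variables. -/
abbrev ML (P : Type) : Type := Schema P Empty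

/-- Simultaneous replacement of the schema variables by modal formulas. -/
def Schema.subst {P T : Type} (σ : T → ML P) : Schema P T → ML P
  | .top => .top
  | .prop p => .prop p
  | .var X => σ X
  | .neg φ => .neg (φ.subst σ)
  | .conj φ ψ => .conj (φ.subst σ) (ψ.subst σ)
  | .dia φ => .dia (φ.subst σ)

/-- Number of occurrences of proposition symbols, schema variables and operators. -/
def Schema.length {P T : Type} : Schema P T → ℕ
  | .top => 1
  | .prop _ => 1
  | .var _ => 1
  | .neg φ => φ.length + 1
  | .conj φ ψ => φ.length + ψ.length + 1
  | .dia φ => φ.length + 1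

/-- Maximum nesting depth of diamonds. -/
def Schema.modalDepth {P T : Type} : Schema P T → ℕ
  | .top => 0
  | .prop _ => 0
  | .var _ => 0
  | .neg φ => φ.modalDepth
  | .conj φ ψ => max φ.modalDepth ψ.modalDepth
  | .dia φ => φ.modalDepth + 1

/-- A Kripke model with domain `W` over the finite set `Sig` of proposition symbols. -/
structure KripkeModel {PROP : Type} (Sig : Finset PROP) (W : Type) where
  rel : W → W → Prop
  val : Sig → Set W

/-- Truth of a modal formula at a node. -/
def KripkeModel.Sat {PROP : Type} {Sig : Finset PROP} {W : Type} (M : KripkeModel Sig W) :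
    W → ML Sig → Prop
  | _, .top => True
  | w, .prop p => w ∈ M.val p
  | _, .var X => X.elim
  | w, .neg φ => ¬ M.Sat w φ
  | w, .conj φ ψ => M.Sat w φ ∧ M.Sat w ψ
  | w, .dia φ => ∃ v, M.rel w v ∧ M.Sat v φ

/-- The set of successors (neighbours) of a node. -/
def KripkeModel.succ {PROP : Type} {Sig : Finset PROP} {W : Type} (M : KripkeModel Sig W)
    (w : W) : Set W := {v | M.rel w v}

open Classical in
/-- The local input of a node: the bit string of the truth values of the proposition symbols. -/
noncomputable def KripkeModel.localInput {PROP : Type} {Sig : Finset PROP} {W : Type}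
    (M : KripkeModel Sig W) (w : W) : Sig → Bool :=
  fun p => decide (w ∈ M.val p)

/-- The identifier of a node: the bit string of the truth values of the distinguished proposition
symbols (those in `D`). Identifiers are compared lexicographically, the bit of the smallest
symbol being the first one. -/
noncomputable def KripkeModel.ident {PROP : Type} {Sig : Finset PROP} {W : Type}
    (M : KripkeModel Sig W) (D : Set PROP) (w : W) :
    Lex ({p : Sig // (p : PROP) ∈ D} → Bool) :=
  toLex fun p => M.localInput w p.1

/-- Finite Kripke models with identifiers and with all out-degrees at most `Δ`. -/
structure KripkeModel.InClass {PROP : Type} {Sig : Finset PROP} {W : Type}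
    (M : KripkeModel Sig W) (D : Set PROP) (Δ : ℕ) : Prop where
  nonempty : Nonempty W
  finite : Finite W
  identifiers : Function.Injective (M.ident D)
  outDegree : ∀ w, (M.succ w).ncard ≤ Δ

/-- `v` is the neighbour number `j` of `w` in the order of identifiers, counted from `0`. -/
def KripkeModel.IsNeighbour {PROP : Type} [LinearOrder PROP] {Sig : Finset PROP} {W : Type}
    (M : KripkeModel Sig W) (D : Set PROP) (w : W) (j : ℕ) (v : W) : Prop :=
  v ∈ M.succ w ∧ {u | u ∈ M.succ w ∧ M.ident D u < M.ident D v}.ncard = j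

/-! ### Acceptance and output of sequences of bit strings -/

/-- The sequence `S` of bit strings (with bit positions in `I`) accepts in round `n` with respect
to the attention positions `A`. -/
def AcceptsInRound {I : Type} (S : ℕ → I → Bool) (A : Finset I) (n : ℕ) : Prop :=
  (∃ i ∈ A, S n i = true) ∧ ∀ m < n, ∀ i ∈ A, S m i = false

/-- The substring of `b` with positions in `P`. -/
def substring {I : Type} [LinearOrder I] (P : Finset I) (b : I → Bool) : List Bool :=
  (P.sort (· ≤ ·)).map b

/-- The sequence `S` outputs the string `s` in round `n` with respect to the attention positions
`A` and the print positions `P`. -/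
def OutputsInRound {I : Type} [LinearOrder I] (S : ℕ → I → Bool) (A P : Finset I) (n : ℕ)
    (s : List Bool) : Prop :=
  AcceptsInRound S A n ∧ s = substring P (S n)

/-! ### Programs of modal substitution calculus -/

/-- A program over `Sig`: a finite nonempty set of head predicates, a terminal and an iteration
clause for each of them, and the sets of attention and print predicates. -/
structure Program {PROP : Type} (VAR : Type) (Sig : Finset PROP) where
  heads : Finset VAR
  heads_nonempty : heads.Nonempty
  terminal : heads → ML Sig
  iteration : heads → Schema Sig heads
  attention : Finset heads
  print : Finset heads

namespace Program

/-- The `n`th iteration formula of a head predicate. -/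
def iter {PROP VAR : Type} {Sig : Finset PROP} (Λ : Program VAR Sig) : ℕ → Λ.heads → ML Sig
  | 0 => Λ.terminal
  | n + 1 => fun Y => (Λ.iteration Y).subst (Λ.iter n)

/-- The number of occurrences of proposition symbols, head predicates and operators in the
program; every clause has, besides its body, one occurrence of its head predicate. -/
def length {PROP VAR : Type} {Sig : Finset PROP} (Λ : Program VAR Sig) : ℕ :=
  ∑ Y : Λ.heads, (((Λ.terminal Y).length + 1) + ((Λ.iteration Y).length + 1))

/-- The maximum modal depth of the bodies of the clauses. -/
def modalDepth {PROP VAR : Type} {Sig : Finset PROP} (Λ : Program VAR Sig) : ℕ :=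
  Finset.univ.sup fun Y : Λ.heads => max (Λ.terminal Y).modalDepth (Λ.iteration Y).modalDepth

open Classical in
/-- The global configuration of round `n`. -/
noncomputable def config {PROP VAR : Type} {Sig : Finset PROP} (Λ : Program VAR Sig) {W : Type}
    (M : KripkeModel Sig W) (n : ℕ) (w : W) : Λ.heads → Bool :=
  fun Y => decide (M.Sat w (Λ.iter n Y))

/-- The program outputs `s` at the node `w` in round `n`. The bits of the output are in the order
of the print predicates. -/
def Outputs {PROP VAR : Type} [LinearOrder VAR] {Sig : Finset PROP} (Λ : Program VAR Sig)
    {W : Type} (M : KripkeModel Sig W) (w : W) (n : ℕ) (s : List Bool) : Prop :=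
  OutputsInRound (fun t => Λ.config M t w) Λ.attention Λ.print n s

end Program

/-! ### Boolean circuits -/

/-- Labels of the gates that are not input gates. -/
inductive Op : Type where
  | and
  | or
  | not

/-- A Boolean circuit whose input gates are indexed by `ι` and whose output gates are indexed by
`κ`. `edge g h` means that the gate `g` feeds the gate `h`. The unlabeled gates are the input gates;
the output gates are exactly the gates of fan-out zero; `∧` and `∨` gates may have any fan-in. -/
structure Circuit (ι κ : Type) where
  Gate : Type
  fintypeGate : Fintype Gate
  edge : Gate → Gate → Prop
  acyclic : ∀ g, ¬ Relation.TransGen edge g g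
  label : Gate → Option Op
  input_fanIn : ∀ g, label g = none → ∀ h, ¬ edge h g
  not_fanIn : ∀ g, label g = some Op.not → ∃! h, edge h g
  input : ι ≃ {g : Gate // label g = none}
  output : κ ≃ {g : Gate // ∀ h, ¬ edge g h}

namespace Circuit

/-- The number of gates. -/
def size {ι κ : Type} (C : Circuit ι κ) : ℕ := @Fintype.card C.Gate C.fintypeGate

theorem wellFounded_edge {ι κ : Type} (C : Circuit ι κ) : WellFounded C.edge := by
  have := C.fintypeGate
  have : IsTrans C.Gate (Relation.TransGen C.edge) := ⟨fun _ _ _ => Relation.TransGen.trans⟩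
  have : Std.Irrefl (Relation.TransGen C.edge) := ⟨C.acyclic⟩
  exact Subrelation.wf (fun h => Relation.TransGen.single h)
    (Finite.wellFounded_of_trans_of_irrefl (Relation.TransGen C.edge))

open Classical in
/-- The value of a gate, given the values of the gates that feed it. -/
noncomputable def evalStep {ι κ : Type} (C : Circuit ι κ) (x : ι → Bool) (g : C.Gate)
    (rec : ∀ h, C.edge h g → Bool) : Bool :=
  match hg : C.label g with
  | none => x (C.input.symm ⟨g, hg⟩)
  | some .and => decide (∀ h (e : C.edge h g), rec h e = true)
  | some .or => decide (∃ h, ∃ e : C.edge h g, rec h e = true)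
  | some .not => decide (∀ h (e : C.edge h g), rec h e = false)

/-- The value of a gate on the input `x`. -/
noncomputable def eval {ι κ : Type} (C : Circuit ι κ) (x : ι → Bool) : C.Gate → Bool :=
  C.wellFounded_edge.fix (C.evalStep x)

/-- The function computed by the circuit. -/
noncomputable def run {ι κ : Type} (C : Circuit ι κ) (x : ι → Bool) : κ → Bool :=
  fun i => C.eval x (C.output i).1

end Circuit

/-! ### Message passing circuits -/

/-- A message passing circuit for `(Sig, Δ)` of state length `k`. Its input consists of one bit for
each symbol of `Sig` followed by `Δ + 1` strings of length `k`: the string number `0` is the node's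
own state, and the string number `j + 1` belongs to the neighbour number `j`. -/
structure MPC {PROP : Type} (Sig : Finset PROP) (Δ : ℕ) where
  k : ℕ
  circuit : Circuit (Sig ⊕ (Fin (Δ + 1) × Fin k)) (Fin k)
  attention : Finset (Fin k)
  print : Finset (Fin k)

namespace MPC

/-- The number of gates of the circuit. -/
def size {PROP : Type} {Sig : Finset PROP} {Δ : ℕ} (C : MPC Sig Δ) : ℕ := C.circuit.size

open Classical in
/-- The strings received by `w` when the current states are `f`: its own state, then the states of
its neighbours in the order of their identifiers, then zero strings for the missing neighbours. -/
noncomputable def received {PROP : Type} [LinearOrder PROP] {Sig : Finset PROP} {Δ : ℕ}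
    (C : MPC Sig Δ) {W : Type} (M : KripkeModel Sig W) (D : Set PROP) (f : W → Fin C.k → Bool)
    (w : W) : Fin (Δ + 1) → Fin C.k → Bool :=
  Fin.cons (f w) fun j => fun b => decide (∃ v, M.IsNeighbour D w j v ∧ f v b = true)

/-- The global configuration (the states of all the nodes) of round `n`. -/
noncomputable def config {PROP : Type} [LinearOrder PROP] {Sig : Finset PROP} {Δ : ℕ}
    (C : MPC Sig Δ) {W : Type} (M : KripkeModel Sig W) (D : Set PROP) :
    ℕ → W → Fin C.k → Bool
  | 0 => fun w => C.circuit.run (Sum.elim (M.localInput w) fun _ => false)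
  | n + 1 => fun w => C.circuit.run
      (Sum.elim (M.localInput w) fun jb => C.received M D (C.config M D n) w jb.1 jb.2)

/-- The circuit outputs `s` at the node `w` in round `n`. -/
def Outputs {PROP : Type} [LinearOrder PROP] {Sig : Finset PROP} {Δ : ℕ} (C : MPC Sig Δ)
    {W : Type} (M : KripkeModel Sig W) (D : Set PROP) (w : W) (n : ℕ) (s : List Bool) : Prop :=
  OutputsInRound (fun t => C.config M D t w) C.attention C.print n s

end MPC

/-- A program over `Sig` and a message passing circuit for `(Sig, Δ)` are equivalent: at every node
of every suitable model (a finite model over `Sig` with identifiers and out-degrees at most `Δ`)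
they produce the same output, or neither of them produces an output. -/
def Equivalent {PROP VAR : Type} [LinearOrder PROP] [LinearOrder VAR] {Sig : Finset PROP} {Δ : ℕ}
    (D : Set PROP) (Λ : Program VAR Sig) (C : MPC Sig Δ) : Prop :=
  ∀ (W : Type) (M : KripkeModel Sig W), M.InClass D Δ → ∀ (w : W) (s : List Bool),
    (∃ n, Λ.Outputs M w n s) ↔ ∃ n, C.Outputs M D w n s

/-- At every node of every suitable model where the program produces its output in round `n` and
the circuit produces its output in round `n'`, the number `n' + 1` of rounds computed by the circuit
is at most `c` times the number `n + 1` of rounds computed by the program. -/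
def TimeFactorAtMost {PROP VAR : Type} [LinearOrder PROP] [LinearOrder VAR] {Sig : Finset PROP}
    {Δ : ℕ} (D : Set PROP) (Λ : Program VAR Sig) (C : MPC Sig Δ) (c : ℕ) : Prop :=
  ∀ (W : Type) (M : KripkeModel Sig W), M.InClass D Δ → ∀ (w : W) (n n' : ℕ) (s s' : List Bool),
    Λ.Outputs M w n s → C.Outputs M D w n' s' → n' + 1 ≤ c * (n + 1)

end MSC

/-!
Adding one variable that is true from round `1` on turns the terminal clauses into parts of the
iteration clauses, so a program may be regarded as a system of schemata `Y := S Y` whose variables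
are all false at the start. If `d` is the modal depth of the system, one round of it is simulated by
a phase of `d + 1` rounds of a circuit. The state of a node holds the current values of the
variables, one bit for every subschema and a unary clock. In every round the Boolean connectives
are evaluated by gates, while a subschema `◇φ` reads the bit of `φ` in the previous states of the
neighbours; thus the bits of the subschemata of modal depth less than `t` are correct after `t`
rounds of a phase. At the end of the phase the clock makes every variable `Y` take the value of the
bit of `S Y`. Since the variables are constant during a phase and false before the end of the first
one, they themselves serve as attention and print bits.
-/

namespace MSC

/-! ### Netlists -/

/-- The description of a gate by the wires that feed it: a conjunction or a disjunction of a set of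
wires, or the negation of a wire. -/
inductive GateDesc (α : Type) : Type where
  | all : Set α → GateDesc α
  | any : Set α → GateDesc α
  | not : α → GateDesc α

namespace GateDesc

variable {α : Type}

/-- The wires that feed a gate. -/
def support : GateDesc α → Set α
  | all s => s
  | any s => s
  | not a => {a}

/-- The label of a gate in a Boolean circuit. -/
def op : GateDesc α → Op
  | all _ => .and
  | any _ => .or
  | not _ => .not

/-- The truth value of a gate when the true wires are those with `v`. -/
def Holds (v : α → Prop) : GateDesc α → Prop
  | all s => ∀ a ∈ s, v a
  | any s => ∃ a ∈ s, v a
  | not a => ¬ v a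

end GateDesc

/-- A netlist with inputs `ι`, outputs `κ` and gates `G`; its wires are `ι ⊕ G`. In contrast to the
outputs of a circuit, an output of a netlist may be any wire, a wire may be several outputs at
once, and a wire that is not an output may be unused. -/
structure Netlist (ι κ G : Type) where
  desc : G → GateDesc (ι ⊕ G)
  wf : WellFounded fun h g => Sum.inr h ∈ (desc g).support
  out : κ → ι ⊕ G

/-- The gates of the circuit of a netlist: its wires, a true gate `one`, a gate `sink` that is fed
by all of these and hence true, and the outputs. The sink feeds the outputs, so that no wire has
fan-out zero. -/
inductive NetGate (ι κ G : Type) : Type where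
  | wire : ι ⊕ G → NetGate ι κ G
  | one : NetGate ι κ G
  | sink : NetGate ι κ G
  | out : κ → NetGate ι κ G

namespace NetGate

/-- The gates of the circuit of a netlist as a sum type, for counting them. -/
def equivSum (ι κ G : Type) : NetGate ι κ G ≃ (ι ⊕ G) ⊕ Bool ⊕ κ where
  toFun
    | wire a => .inl a
    | one => .inr (.inl true)
    | sink => .inr (.inl false)
    | out k => .inr (.inr k)
  invFun
    | .inl a => wire a
    | .inr (.inl true) => one
    | .inr (.inl false) => sink
    | .inr (.inr k) => out k
  left_inv g := by cases g <;> rfl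
  right_inv g := by rcases g with a | (_ | _) | k <;> rfl

instance {ι κ G : Type} [Fintype ι] [Fintype κ] [Fintype G] : Fintype (NetGate ι κ G) :=
  Fintype.ofEquiv _ (equivSum ι κ G).symm

end NetGate

namespace Netlist

variable {ι κ G : Type} (N : Netlist ι κ G)

/-- The edges of the circuit of a netlist. -/
inductive Edge : NetGate ι κ G → NetGate ι κ G → Prop
  | feed {a : ι ⊕ G} {g : G} (h : a ∈ (N.desc g).support) : Edge (.wire a) (.wire (.inr g))
  | wire_sink (a : ι ⊕ G) : Edge (.wire a) .sink
  | one_sink : Edge .one .sink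
  | sink_out (k : κ) : Edge .sink (.out k)
  | wire_out (k : κ) : Edge (.wire (N.out k)) (.out k)

/-- The labels of the circuit of a netlist. -/
def label : NetGate ι κ G → Option Op
  | .wire (.inl _) => none
  | .wire (.inr g) => some (N.desc g).op
  | .one => some .and
  | .sink => some .or
  | .out _ => some .and

theorem wellFounded_edge : WellFounded N.Edge := by
  have acc_input (i : ι) : Acc N.Edge (.wire (.inl i)) := ⟨_, fun _ h => nomatch h⟩
  have acc_gate (g : G) : Acc N.Edge (.wire (.inr g)) := by
    induction g using N.wf.induction with
    | _ g ih =>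
      refine ⟨_, ?_⟩
      rintro _ @⟨i | h, _, hg⟩
      · exact acc_input i
      · exact ih h hg
  have acc_wire : ∀ a, Acc N.Edge (.wire a)
    | .inl i => acc_input i
    | .inr g => acc_gate g
  have acc_one : Acc N.Edge .one := ⟨_, fun _ h => nomatch h⟩
  have acc_sink : Acc N.Edge .sink := ⟨_, fun
    | _, .wire_sink a => acc_wire a
    | _, .one_sink => acc_one⟩
  exact ⟨fun
    | .wire a => acc_wire a
    | .one => acc_one
    | .sink => acc_sink
    | .out _ => ⟨_, fun
      | _, .sink_out _ => acc_sink
      | _, .wire_out _ => acc_wire _⟩⟩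

theorem edge_gate_iff {g : G} {h : NetGate ι κ G} :
    N.Edge h (.wire (.inr g)) ↔ ∃ a ∈ (N.desc g).support, .wire a = h :=
  ⟨fun | .feed ha => ⟨_, ha, rfl⟩, fun ⟨_, ha, e⟩ => e ▸ .feed ha⟩

theorem existsUnique_edge_of_label_eq_not {g : NetGate ι κ G} (hg : N.label g = some .not) :
    ∃! h, N.Edge h g := by
  rcases g with (i | g) | _ | _ | k
  case wire.inr =>
    have hop : (N.desc g).op = .not := Option.some.inj hg
    simp only [edge_gate_iff]
    cases hd : N.desc g with
    | not a => simp [GateDesc.support, ExistsUnique]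
    | _ => simp [hd, GateDesc.op] at hop
  all_goals cases hg

/-- The input gates of the circuit of a netlist are its input wires. -/
def inputEquiv : ι ≃ {g : NetGate ι κ G // N.label g = none} where
  toFun i := ⟨.wire (.inl i), rfl⟩
  invFun
    | ⟨.wire (.inl i), _⟩ => i
  left_inv _ := rfl
  right_inv
    | ⟨.wire (.inl _), _⟩ => rfl

theorem forall_not_edge_iff [Nonempty κ] {g : NetGate ι κ G} :
    (∀ h, ¬ N.Edge g h) ↔ ∃ k, .out k = g := by
  constructor
  · intro hg
    cases g with
    | wire a => exact (hg _ (.wire_sink a)).elim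
    | one => exact (hg _ .one_sink).elim
    | sink => exact (hg _ (.sink_out (Classical.arbitrary κ))).elim
    | out k => exact ⟨k, rfl⟩
  · rintro ⟨k, rfl⟩ h ⟨⟩

/-- The gates of fan-out zero of the circuit of a netlist are its outputs. -/
noncomputable def outputEquiv [Nonempty κ] : κ ≃ {g : NetGate ι κ G // ∀ h, ¬ N.Edge g h} :=
  (Equiv.ofInjective NetGate.out fun _ _ => NetGate.out.inj).trans
    (Equiv.subtypeEquivRight fun _ => N.forall_not_edge_iff.symm)

variable [Fintype ι] [Fintype κ] [Nonempty κ] [Fintype G]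

/-- The circuit of a netlist. -/
noncomputable def toCircuit : Circuit ι κ where
  Gate := NetGate ι κ G
  fintypeGate := inferInstance
  edge := N.Edge
  acyclic g := N.wellFounded_edge.transGen.irrefl.irrefl g
  label := N.label
  input_fanIn g hg h e := by cases e <;> cases hg
  not_fanIn _ := N.existsUnique_edge_of_label_eq_not
  input := N.inputEquiv
  output := N.outputEquiv

theorem size_toCircuit :
    N.toCircuit.size = Fintype.card ι + Fintype.card G + 2 + Fintype.card κ := by
  change Fintype.card (NetGate ι κ G) = _
  rw [Fintype.card_congr (NetGate.equivSum ι κ G)]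
  simp only [Fintype.card_sum, Fintype.card_bool]
  ring

end Netlist

namespace Circuit

variable {ι κ : Type} (C : Circuit ι κ) (x : ι → Bool) {g : C.Gate}

theorem eval_eq_evalStep (g : C.Gate) : C.eval x g = C.evalStep x g fun h _ => C.eval x h :=
  C.wellFounded_edge.fix_eq _ _

theorem eval_of_label_eq_none (hg : C.label g = none) :
    C.eval x g = x (C.input.symm ⟨g, hg⟩) := by
  rw [eval_eq_evalStep, evalStep]
  split <;> simp_all

theorem eval_of_label_eq_and (hg : C.label g = some .and) :
    C.eval x g = true ↔ ∀ h, C.edge h g → C.eval x h = true := by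
  rw [eval_eq_evalStep, evalStep]
  split <;> simp_all

theorem eval_of_label_eq_or (hg : C.label g = some .or) :
    C.eval x g = true ↔ ∃ h, C.edge h g ∧ C.eval x h = true := by
  rw [eval_eq_evalStep, evalStep]
  split <;> simp_all

theorem eval_of_label_eq_not (hg : C.label g = some .not) :
    C.eval x g = true ↔ ∀ h, C.edge h g → ¬ C.eval x h = true := by
  rw [eval_eq_evalStep, evalStep]
  split <;> simp_all

end Circuit

namespace Netlist

variable {ι κ G : Type} [Fintype ι] [Fintype κ] [Nonempty κ] [Fintype G] (N : Netlist ι κ G)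
  (x : ι → Bool)

/-- The truth value of a wire of a netlist on the input `x`. -/
def Val (a : ι ⊕ G) : Prop := N.toCircuit.eval x (.wire a) = true

theorem val_inl (i : ι) : N.Val x (.inl i) ↔ x i = true :=
  iff_of_eq (congrArg (· = true)
    (N.toCircuit.eval_of_label_eq_none x (g := .wire (.inl i)) rfl))

theorem val_inr (g : G) : N.Val x (.inr g) ↔ (N.desc g).Holds (N.Val x) := by
  have edge_iff (h : NetGate ι κ G) :
      N.toCircuit.edge h (.wire (.inr g)) ↔ ∃ a ∈ (N.desc g).support, .wire a = h :=
    N.edge_gate_iff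
  have label_eq : N.toCircuit.label (.wire (.inr g)) = some (N.desc g).op := rfl
  cases hd : N.desc g <;> rw [hd] at edge_iff label_eq
  case all s =>
    refine (N.toCircuit.eval_of_label_eq_and x label_eq).trans
      ((forall_congr' fun h => imp_congr_left (edge_iff h)).trans Set.forall_mem_image)
  case any s =>
    refine (N.toCircuit.eval_of_label_eq_or x label_eq).trans
      ((exists_congr fun h => and_congr_left' (edge_iff h)).trans Set.exists_mem_image)
  case not a =>
    refine (N.toCircuit.eval_of_label_eq_not x label_eq).trans
      ((forall_congr' fun h => imp_congr_left (edge_iff h)).trans ?_)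
    exact Set.forall_mem_image.trans forall_eq

theorem eval_one : N.toCircuit.eval x .one = true :=
  (N.toCircuit.eval_of_label_eq_and x (g := .one) rfl).2 fun _ h => nomatch h

theorem eval_sink : N.toCircuit.eval x .sink = true :=
  (N.toCircuit.eval_of_label_eq_or x (g := .sink) rfl).2 ⟨.one, .one_sink, N.eval_one x⟩

theorem run_toCircuit_iff (k : κ) : N.toCircuit.run x k = true ↔ N.Val x (N.out k) := by
  refine (N.toCircuit.eval_of_label_eq_and x (g := .out k) rfl).trans
    ⟨fun h => h _ (.wire_out k), fun h => ?_⟩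
  rintro _ (_ | _)
  · exact N.eval_sink x
  · exact h

end Netlist

/-! ### Schemata -/

namespace Schema

variable {P T T' : Type}

noncomputable instance : DecidableEq (Schema P T) := Classical.decEq _

/-- Renaming of the schema variables. -/
def map (f : T → T') : Schema P T → Schema P T'
  | .top => .top
  | .prop p => .prop p
  | .var X => .var (f X)
  | .neg φ => .neg (φ.map f)
  | .conj φ ψ => .conj (φ.map f) (ψ.map f)
  | .dia φ => .dia (φ.map f)

/-- The conditional schema: if `χ` then `φ` else `ψ`. -/
def ite (χ φ ψ : Schema P T) : Schema P T :=
  .conj (.neg (.conj χ (.neg φ))) (.neg (.conj (.neg χ) (.neg ψ)))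

theorem length_map (f : T → T') (φ : Schema P T) : (φ.map f).length = φ.length := by
  induction φ with
  | _ => simp_all only [map, length]

theorem modalDepth_map (f : T → T') (φ : Schema P T) : (φ.map f).modalDepth = φ.modalDepth := by
  induction φ with
  | _ => simp_all only [map, modalDepth]

theorem length_pos (φ : Schema P T) : 0 < φ.length := by
  cases φ <;> simp [length]

theorem modalDepth_le_length (φ : Schema P T) : φ.modalDepth ≤ φ.length := by
  induction φ with
  | _ => simp only [modalDepth, length]; omega

/-- The subschemata of a schema, including the schema itself. -/
noncomputable def subschemata : Schema P T → Finset (Schema P T)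
  | .top => {.top}
  | .prop p => {.prop p}
  | .var X => {.var X}
  | .neg φ => insert (.neg φ) φ.subschemata
  | .conj φ ψ => insert (.conj φ ψ) (φ.subschemata ∪ ψ.subschemata)
  | .dia φ => insert (.dia φ) φ.subschemata

theorem self_mem_subschemata (φ : Schema P T) : φ ∈ φ.subschemata := by
  cases φ <;> simp [subschemata]

theorem subschemata_subset {φ χ : Schema P T} (h : φ ∈ χ.subschemata) :
    φ.subschemata ⊆ χ.subschemata := by
  induction χ with
  | neg ψ ih | dia ψ ih =>
    rcases Finset.mem_insert.1 h with rfl | h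
    · rfl
    · exact (ih h).trans (Finset.subset_insert _ _)
  | conj ψ₁ ψ₂ ih₁ ih₂ =>
    rcases Finset.mem_insert.1 h with rfl | h
    · rfl
    · refine .trans ?_ (Finset.subset_insert _ _)
      rcases Finset.mem_union.1 h with h | h
      · exact (ih₁ h).trans Finset.subset_union_left
      · exact (ih₂ h).trans Finset.subset_union_right
  | _ => rw [Finset.mem_singleton.1 h]

theorem card_subschemata_le (φ : Schema P T) : φ.subschemata.card ≤ φ.length := by
  induction φ with
  | neg φ ih | dia φ ih => exact (Finset.card_insert_le _ _).trans (Nat.succ_le_succ ih)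
  | conj φ ψ ihφ ihψ =>
    exact (Finset.card_insert_le _ _).trans (Nat.succ_le_succ
      ((Finset.card_union_le _ _).trans (Nat.add_le_add ihφ ihψ)))
  | _ => exact le_rfl

section Truth

variable {PROP W : Type} {Sig : Finset PROP} (M : KripkeModel Sig W)

/-- Truth of a schema at a node when the truth values of the schema variables are given by `H`. -/
def Holds (H : W → T → Prop) : Schema Sig T → W → Prop
  | .top, _ => True
  | .prop p, w => w ∈ M.val p
  | .var X, w => H w X
  | .neg φ, w => ¬ φ.Holds H w
  | .conj φ ψ, w => φ.Holds H w ∧ ψ.Holds H w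
  | .dia φ, w => ∃ v, M.rel w v ∧ φ.Holds H v

theorem holds_map (f : T → T') (H : W → T' → Prop) (φ : Schema Sig T) (w : W) :
    (φ.map f).Holds M H w ↔ φ.Holds M (fun v X => H v (f X)) w := by
  induction φ generalizing w with
  | _ => simp_all only [map, Holds]

theorem holds_ite (H : W → T → Prop) (χ φ ψ : Schema Sig T) (w : W) :
    (ite χ φ ψ).Holds M H w ↔
      (χ.Holds M H w → φ.Holds M H w) ∧ (¬ χ.Holds M H w → ψ.Holds M H w) := by
  simp only [ite, Holds, not_and, not_not]

theorem sat_subst (σ : T → ML Sig) (φ : Schema Sig T) (w : W) :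
    M.Sat w (φ.subst σ) ↔ φ.Holds M (fun v X => M.Sat v (σ X)) w := by
  induction φ generalizing w with
  | _ => simp_all only [subst, KripkeModel.Sat, Holds]

theorem holds_iff_sat (H : W → Empty → Prop) (φ : ML Sig) (w : W) :
    φ.Holds M H w ↔ M.Sat w φ := by
  induction φ generalizing w with
  | var X => exact X.elim
  | _ => simp_all only [KripkeModel.Sat, Holds]

end Truth

end Schema

/-! ### Systems of schemata -/

/-- A system of simultaneous recursive definitions: in every round, each variable `Y` takes the
truth value that the schema `S Y` has in the previous round. -/
abbrev System (P T : Type) : Type := T → Schema P T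

namespace System

section Basic

variable {P T : Type} [Fintype T] (S : System P T)

/-- The total length of the schemata of a system. -/
def length : ℕ := ∑ Y, (S Y).length

/-- The maximum modal depth of the schemata of a system. -/
def modalDepth : ℕ := Finset.univ.sup fun Y => (S Y).modalDepth

/-- The subschemata of the schemata of a system. -/
noncomputable def subschemata : Finset (Schema P T) :=
  Finset.univ.biUnion fun Y => (S Y).subschemata

variable {S}

theorem mem_subschemata {φ : Schema P T} : φ ∈ S.subschemata ↔ ∃ Y, φ ∈ (S Y).subschemata := by
  simp [subschemata]

theorem apply_mem_subschemata (S : System P T) (Y : T) : S Y ∈ S.subschemata :=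
  mem_subschemata.2 ⟨Y, (S Y).self_mem_subschemata⟩

theorem subschemata_subset {φ : Schema P T} (h : φ ∈ S.subschemata) :
    φ.subschemata ⊆ S.subschemata := fun _ hψ =>
  let ⟨Y, hY⟩ := mem_subschemata.1 h
  mem_subschemata.2 ⟨Y, Schema.subschemata_subset hY hψ⟩

theorem mem_of_neg_mem {φ : Schema P T} (h : φ.neg ∈ S.subschemata) : φ ∈ S.subschemata :=
  subschemata_subset h (Finset.mem_insert_of_mem φ.self_mem_subschemata)

theorem mem_of_dia_mem {φ : Schema P T} (h : φ.dia ∈ S.subschemata) : φ ∈ S.subschemata :=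
  subschemata_subset h (Finset.mem_insert_of_mem φ.self_mem_subschemata)

theorem left_mem_of_conj_mem {φ ψ : Schema P T} (h : φ.conj ψ ∈ S.subschemata) :
    φ ∈ S.subschemata :=
  subschemata_subset h
    (Finset.mem_insert_of_mem (Finset.mem_union_left _ φ.self_mem_subschemata))

theorem right_mem_of_conj_mem {φ ψ : Schema P T} (h : φ.conj ψ ∈ S.subschemata) :
    ψ ∈ S.subschemata :=
  subschemata_subset h
    (Finset.mem_insert_of_mem (Finset.mem_union_right _ ψ.self_mem_subschemata))

variable (S)

theorem card_subschemata_le : S.subschemata.card ≤ S.length :=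
  Finset.card_biUnion_le.trans (Finset.sum_le_sum fun Y _ => (S Y).card_subschemata_le)

theorem card_le_length : Fintype.card T ≤ S.length := by
  rw [← Finset.card_univ, Finset.card_eq_sum_ones]
  exact Finset.sum_le_sum fun Y _ => (S Y).length_pos

theorem modalDepth_apply_le (Y : T) : (S Y).modalDepth ≤ S.modalDepth :=
  Finset.le_sup (f := fun Y => (S Y).modalDepth) (Finset.mem_univ Y)

theorem modalDepth_le_length : S.modalDepth ≤ S.length :=
  Finset.sup_le fun Y _ => (S Y).modalDepth_le_length.trans
    (Finset.single_le_sum (f := fun Y => (S Y).length) (fun _ _ => Nat.zero_le _)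
      (Finset.mem_univ Y))

end Basic

/-- The truth values of the variables of a system after `n` rounds, all of them being false at the
start. -/
def stage {PROP T W : Type} {Sig : Finset PROP} (S : System Sig T) (M : KripkeModel Sig W) :
    ℕ → W → T → Prop
  | 0 => fun _ _ => False
  | n + 1 => fun w Y => (S Y).Holds M (S.stage M n) w

/-! ### The simulating circuit -/

section Circuit

variable {P T : Type} [Fintype T] (S : System P T)

/-- The bits of the state of the simulating circuit: the values of the variables and of the
subschemata, and a clock in unary notation. -/
inductive StateBit : Type where
  | var : T → StateBit
  | sub : S.subschemata → StateBit
  | clock : Fin S.modalDepth → StateBit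

/-- The gates of the simulating circuit: those that compute the bits of the next state, the gate
`tick` that is true in the last round of a phase, its negation, and for every variable `Y` the value
`update Y` of `S Y` in the last round and the old value `keep Y` in the other rounds. -/
inductive Gate : Type where
  | bit : S.StateBit → Gate
  | tick : Gate
  | notTick : Gate
  | update : T → Gate
  | keep : T → Gate

/-- The bits of the state as a sum type, for enumerating them. -/
def StateBit.equivSum : S.StateBit ≃ T ⊕ S.subschemata ⊕ Fin S.modalDepth where
  toFun
    | var Y => .inl Y
    | sub φ => .inr (.inl φ)
    | clock i => .inr (.inr i)
  invFun
    | .inl Y => var Y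
    | .inr (.inl φ) => sub φ
    | .inr (.inr i) => clock i
  left_inv b := by cases b <;> rfl
  right_inv b := by rcases b with Y | φ | i <;> rfl

/-- The gates as a sum type, for counting them. -/
def Gate.equivSum : S.Gate ≃ S.StateBit ⊕ Bool ⊕ T ⊕ T where
  toFun
    | bit b => .inl b
    | tick => .inr (.inl true)
    | notTick => .inr (.inl false)
    | update Y => .inr (.inr (.inl Y))
    | keep Y => .inr (.inr (.inr Y))
  invFun
    | .inl b => bit b
    | .inr (.inl true) => tick
    | .inr (.inl false) => notTick
    | .inr (.inr (.inl Y)) => update Y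
    | .inr (.inr (.inr Y)) => keep Y
  left_inv g := by cases g <;> rfl
  right_inv g := by rcases g with b | (_ | _) | Y | Y <;> rfl

noncomputable instance : Fintype S.StateBit := Fintype.ofEquiv _ (StateBit.equivSum S).symm

noncomputable instance : Fintype S.Gate := Fintype.ofEquiv _ (Gate.equivSum S).symm

/-- The number of bits of the state of the simulating circuit. -/
noncomputable def stateLength : ℕ := Fintype.card T + (S.subschemata.card + S.modalDepth)

theorem card_stateBit : Fintype.card S.StateBit = S.stateLength := by
  simp [Fintype.card_congr (StateBit.equivSum S), stateLength]

theorem card_gate :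
    Fintype.card S.Gate = S.stateLength + (2 + (Fintype.card T + Fintype.card T)) := by
  simp [Fintype.card_congr (Gate.equivSum S), card_stateBit]

variable [LinearOrder T]

/-- The positions of the bits in the state; the variables come first, in their order. -/
noncomputable def bitEquiv : S.StateBit ≃ Fin S.stateLength :=
  (StateBit.equivSum S).trans <|
    (Equiv.sumCongr (Fintype.orderIsoFinOfCardEq T rfl).symm.toEquiv
      ((Equiv.sumCongr S.subschemata.equivFin (Equiv.refl _)).trans finSumFinEquiv)).trans
        finSumFinEquiv

instance [Nonempty T] : Nonempty (Fin S.stateLength) :=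
  ‹Nonempty T›.map fun Y => S.bitEquiv (.var Y)

/-- The positions of the variables in the state. -/
noncomputable def varEmbedding : T ↪o Fin S.stateLength :=
  OrderEmbedding.ofStrictMono (fun Y => S.bitEquiv (.var Y)) fun _ _ h =>
    Fin.strictMono_castAdd _ ((Fintype.orderIsoFinOfCardEq T rfl).symm.strictMono h)

variable (Δ : ℕ)

/-- The wires of the simulating circuit. -/
abbrev Wire : Type := (P ⊕ (Fin (Δ + 1) × Fin S.stateLength)) ⊕ S.Gate

/-- The wire with a bit of the previous state of the node. -/
noncomputable def ownWire (b : S.StateBit) : S.Wire Δ := .inl (.inr (0, S.bitEquiv b))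

/-- The wire with a bit of the previous state of the neighbour number `j`. -/
noncomputable def neighbourWire (j : Fin Δ) (b : S.StateBit) : S.Wire Δ :=
  .inl (.inr (j.succ, S.bitEquiv b))

/-- The description of the gate of a subschema; a disjunction of a single wire copies that wire. -/
noncomputable def subDesc : S.subschemata → GateDesc (S.Wire Δ)
  | ⟨.top, _⟩ => .all ∅
  | ⟨.prop p, _⟩ => .any {.inl (.inl p)}
  | ⟨.var X, _⟩ => .any {S.ownWire Δ (.var X)}
  | ⟨.neg φ, h⟩ => .not (.inr (.bit (.sub ⟨φ, mem_of_neg_mem h⟩)))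
  | ⟨.conj φ ψ, h⟩ => .all {.inr (.bit (.sub ⟨φ, left_mem_of_conj_mem h⟩)),
      .inr (.bit (.sub ⟨ψ, right_mem_of_conj_mem h⟩))}
  | ⟨.dia φ, h⟩ => .any (Set.range fun j => S.neighbourWire Δ j (.sub ⟨φ, mem_of_dia_mem h⟩))

/-- The descriptions of the gates. After `t` rounds of a phase the clock bits below `t` are on. -/
noncomputable def gateDesc : S.Gate → GateDesc (S.Wire Δ)
  | .bit (.var Y) => .any {.inr (.update Y), .inr (.keep Y)}
  | .bit (.sub φ) => S.subDesc Δ φ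
  | .bit (.clock i) =>
      .all (insert (.inr .notTick) ((fun j => S.ownWire Δ (.clock j)) '' Set.Iio i))
  | .tick => .all (Set.range fun i => S.ownWire Δ (.clock i))
  | .notTick => .not (.inr .tick)
  | .update Y => .all {.inr .tick, .inr (.bit (.sub ⟨S Y, S.apply_mem_subschemata Y⟩))}
  | .keep Y => .all {.inr .notTick, S.ownWire Δ (.var Y)}

/-- A rank of the gates that increases along the wires. -/
def gateRank : S.Gate → ℕ
  | .tick => 0
  | .notTick => 1
  | .bit (.clock _) => 2
  | .bit (.sub φ) => φ.1.length
  | .update Y => (S Y).length + 1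
  | .keep _ => 2
  | .bit (.var Y) => (S Y).length + 3

theorem gateRank_lt_of_mem_support_subDesc {φ : S.subschemata} {h : S.Gate}
    (hh : .inr h ∈ (S.subDesc Δ φ).support) : S.gateRank h < φ.1.length := by
  obtain ⟨φ, hφ⟩ := φ
  cases φ with
  | neg φ =>
    obtain rfl := Sum.inr.inj (Set.mem_singleton_iff.1 hh)
    exact Nat.lt_succ_self _
  | conj φ ψ =>
    rcases hh with e | e <;> obtain rfl := Sum.inr.inj e <;>
      simp only [gateRank, Schema.length] <;> omega
  | _ => simp [subDesc, GateDesc.support, ownWire, neighbourWire] at hh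

theorem gateRank_lt_of_mem_support {g h : S.Gate} (hh : .inr h ∈ (S.gateDesc Δ g).support) :
    S.gateRank h < S.gateRank g := by
  rcases g with (Y | φ | i) | _ | _ | Y | Y
  case bit.sub => exact S.gateRank_lt_of_mem_support_subDesc Δ hh
  case bit.var => rcases hh with e | e <;> obtain rfl := Sum.inr.inj e <;> simp [gateRank]
  case update =>
    rcases hh with e | e <;> obtain rfl := Sum.inr.inj e <;> simp [gateRank]
  all_goals
    simp only [gateDesc, GateDesc.support, ownWire, Set.mem_insert_iff, Set.mem_singleton_iff,
      Set.mem_image, Set.mem_range, Sum.inr.injEq, reduceCtorEq, and_false, exists_false,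
      or_false] at hh
  all_goals simp [hh, gateRank]

/-- The netlist of the simulating circuit. -/
noncomputable def netlist :
    Netlist (P ⊕ (Fin (Δ + 1) × Fin S.stateLength)) (Fin S.stateLength) S.Gate where
  desc := S.gateDesc Δ
  wf := Subrelation.wf (S.gateRank_lt_of_mem_support Δ) (measure S.gateRank).wf
  out i := .inr (.bit (S.bitEquiv.symm i))

end Circuit

section MPC

variable {PROP T : Type} {Sig : Finset PROP} [Fintype T] [LinearOrder T] [Nonempty T]
  (S : System Sig T) (Δ : ℕ) (attn print : Finset T)

/-- The message passing circuit that simulates a system, with the given variables as attention and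
print bits. -/
noncomputable def toMPC : MPC Sig Δ where
  k := S.stateLength
  circuit := (S.netlist Δ).toCircuit
  attention := attn.map S.varEmbedding.toEmbedding
  print := print.map S.varEmbedding.toEmbedding

theorem size_toMPC_le :
    (S.toMPC Δ attn print).size ≤ Sig.card + 3 * (Δ + 4) * S.length + 4 := by
  have size_eq : (S.toMPC Δ attn print).size =
      Sig.card + (Δ + 1) * S.stateLength + Fintype.card S.Gate + 2 + S.stateLength :=
    (S.netlist Δ).size_toCircuit.trans (by simp)
  have stateLength_le : S.stateLength ≤ 3 * S.length := by
    have := S.card_le_length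
    have := S.card_subschemata_le
    have := S.modalDepth_le_length
    rw [stateLength]
    omega
  have card_gate_le : Fintype.card S.Gate ≤ 5 * S.length + 2 := by
    have := S.card_le_length
    rw [card_gate]
    omega
  rw [size_eq]
  nlinarith [Nat.mul_le_mul_left (Δ + 1) stateLength_le]

end MPC

end System

/-! ### Outputs of sequences of bit strings -/

theorem AcceptsInRound.le {I : Type} {G : ℕ → I → Bool} {A : Finset I} {m n : ℕ}
    (hm : AcceptsInRound G A m) (hn : AcceptsInRound G A n) : m ≤ n := by
  by_contra! hlt
  obtain ⟨i, hi, hG⟩ := hn.1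
  simp [hm.2 n hlt i hi] at hG

theorem AcceptsInRound.unique {I : Type} {G : ℕ → I → Bool} {A : Finset I} {m n : ℕ}
    (hm : AcceptsInRound G A m) (hn : AcceptsInRound G A n) : m = n :=
  (hm.le hn).antisymm (hn.le hm)

theorem substring_map {I J : Type} [LinearOrder I] [LinearOrder J] (f : I ↪o J) (P : Finset I)
    (b : J → Bool) : substring (P.map f.toEmbedding) b = substring P fun i => b (f i) := by
  rw [substring, ← (f.strictMono.strictMonoOn P).map_finsetSort]
  exact List.map_map

theorem outputsInRound_map_iff {I J : Type} [LinearOrder I] [LinearOrder J] (f : I ↪o J)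
    {G : ℕ → J → Bool} {A P : Finset I} {n : ℕ} {s : List Bool} :
    OutputsInRound G (A.map f.toEmbedding) (P.map f.toEmbedding) n s ↔
      OutputsInRound (fun t i => G t (f i)) A P n s := by
  simp [OutputsInRound, AcceptsInRound, substring_map]

section Slowdown

variable {I : Type} {G : ℕ → I → Bool} (h0 : ∀ i, G 0 i = false) {k : ℕ} (hk : 0 < k)
include h0 hk

theorem acceptsInRound_div_iff {A : Finset I} {r : ℕ} :
    AcceptsInRound (fun t => G ((t + 1) / k)) A r ↔
      ∃ n, r + 1 = (n + 1) * k ∧ AcceptsInRound (fun t => G (t + 1)) A n := by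
  constructor
  · rintro ⟨⟨i, hi, hG⟩, hlt⟩
    obtain ⟨n, hn⟩ : ∃ n, (r + 1) / k = n + 1 :=
      Nat.exists_eq_succ_of_ne_zero fun e => by simp [e, h0] at hG
    have eq_false_of_lt {m : ℕ} (hm : (m + 1) * k < r + 1) : ∀ j ∈ A, G (m + 1) j = false := by
      obtain ⟨q, hq⟩ := Nat.exists_eq_add_one.2 (show 0 < (m + 1) * k by positivity)
      simpa only [← hq, Nat.mul_div_cancel _ hk] using hlt q (by omega)
    have le_r : (n + 1) * k ≤ r + 1 := hn ▸ Nat.div_mul_le_self _ _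
    simp only [hn] at hG
    refine ⟨n, le_r.antisymm' (le_of_not_gt fun hlt' => ?_), ⟨i, hi, hG⟩, fun m hm => ?_⟩
    · simp [eq_false_of_lt hlt' i hi] at hG
    · exact eq_false_of_lt ((Nat.mul_lt_mul_of_pos_right (Nat.succ_lt_succ hm) hk).trans_le le_r)
  · rintro ⟨n, hr, htrue, hlt⟩
    refine ⟨by simpa [hr, Nat.mul_div_cancel _ hk] using htrue, fun m hm i hi => ?_⟩
    have div_lt : (m + 1) / k < n + 1 := (Nat.div_lt_iff_lt_mul hk).2 (by omega)
    cases hq : (m + 1) / k with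
    | zero => simp only [hq, h0]
    | succ q => simpa only [hq] using hlt q (by omega) i hi

theorem outputsInRound_div_iff [LinearOrder I] {A P : Finset I} {r : ℕ} {s : List Bool} :
    OutputsInRound (fun t => G ((t + 1) / k)) A P r s ↔
      ∃ n, r + 1 = (n + 1) * k ∧ OutputsInRound (fun t => G (t + 1)) A P n s := by
  rw [OutputsInRound, acceptsInRound_div_iff h0 hk]
  constructor
  · rintro ⟨⟨n, hr, hacc⟩, hs⟩
    exact ⟨n, hr, hacc, by simpa [hr, Nat.mul_div_cancel _ hk] using hs⟩
  · rintro ⟨n, hr, hacc, hs⟩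
    exact ⟨⟨n, hr, hacc⟩, by simpa [hr, Nat.mul_div_cancel _ hk] using hs⟩

end Slowdown

/-! ### Rounds of message passing circuits -/

theorem KripkeModel.InClass.exists_isNeighbour_iff {PROP W : Type} [LinearOrder PROP]
    {Sig : Finset PROP} {M : KripkeModel Sig W} {D : Set PROP} {Δ : ℕ} (hM : M.InClass D Δ)
    (w : W) (p : W → Prop) :
    (∃ j : Fin Δ, ∃ v, M.IsNeighbour D w j v ∧ p v) ↔ ∃ v, M.rel w v ∧ p v := by
  refine ⟨fun ⟨_, v, hv, hp⟩ => ⟨v, hv.1, hp⟩, fun ⟨v, hv, hp⟩ => ?_⟩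
  have := hM.finite
  have number_lt : {u | u ∈ M.succ w ∧ M.ident D u < M.ident D v}.ncard < (M.succ w).ncard :=
    Set.ncard_lt_ncard ⟨fun _ hu => hu.1, fun h => lt_irrefl _ (h (show v ∈ M.succ w from hv)).2⟩
  exact ⟨⟨_, number_lt.trans_le (hM.outDegree w)⟩, v, ⟨hv, rfl⟩, hp⟩

namespace MPC

variable {PROP W : Type} [LinearOrder PROP] {Sig : Finset PROP} {Δ : ℕ} (C : MPC Sig Δ)
  (M : KripkeModel Sig W) (D : Set PROP)

/-- The states of the nodes before round `q`: the zero strings before round `0`, and the states of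
round `n` before round `n + 1`. -/
noncomputable def state : ℕ → W → Fin C.k → Bool
  | 0 => fun _ _ => false
  | q + 1 => C.config M D q

theorem state_succ (q : ℕ) (w : W) :
    C.state M D (q + 1) w = C.circuit.run
      (Sum.elim (M.localInput w) fun jb => C.received M D (C.state M D q) w jb.1 jb.2) := by
  cases q with
  | zero =>
    have received_zero (j : Fin (Δ + 1)) (b : Fin C.k) :
        C.received M D (C.state M D 0) w j b = false := by
      cases j using Fin.cases <;> simp [received, state]
    simp only [received_zero]
    rfl
  | succ q => rfl

variable {M D} in
theorem exists_received_succ_iff (hM : M.InClass D Δ) (f : W → Fin C.k → Bool) (w : W)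
    (b : Fin C.k) :
    (∃ j : Fin Δ, C.received M D f w j.succ b = true) ↔ ∃ v, M.rel w v ∧ f v b = true := by
  simp only [received, Fin.cons_succ, decide_eq_true_eq]
  exact hM.exists_isNeighbour_iff w _

end MPC

/-! ### Correctness of the simulation -/

namespace System

variable {PROP T W : Type} {Sig : Finset PROP} [Fintype T] (S : System Sig T)
  (M : KripkeModel Sig W)

variable {S} in
/-- All clock bits are on, so that the next round is the last one of a phase. -/
def ClockFull (σ : S.StateBit → Prop) : Prop := ∀ i, σ (.clock i)

/-- The bits `σ` of the next state of `w` are those that the simulating circuit computes when the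
bits of the current states of the nodes are given by `β`. -/
structure IsRound (β : W → S.StateBit → Prop) (w : W) (σ : S.StateBit → Prop) : Prop where
  sub_top h : σ (.sub ⟨.top, h⟩)
  sub_prop p h : σ (.sub ⟨.prop p, h⟩) ↔ w ∈ M.val p
  sub_var X h : σ (.sub ⟨.var X, h⟩) ↔ β w (.var X)
  sub_neg φ h : σ (.sub ⟨.neg φ, h⟩) ↔ ¬ σ (.sub ⟨φ, mem_of_neg_mem h⟩)
  sub_conj φ ψ h : σ (.sub ⟨.conj φ ψ, h⟩) ↔
    σ (.sub ⟨φ, left_mem_of_conj_mem h⟩) ∧ σ (.sub ⟨ψ, right_mem_of_conj_mem h⟩)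
  sub_dia φ h : σ (.sub ⟨.dia φ, h⟩) ↔ ∃ v, M.rel w v ∧ β v (.sub ⟨φ, mem_of_dia_mem h⟩)
  clock i : σ (.clock i) ↔ ¬ ClockFull (β w) ∧ ∀ j < i, β w (.clock j)
  var Y : σ (.var Y) ↔ ClockFull (β w) ∧ σ (.sub ⟨S Y, S.apply_mem_subschemata Y⟩) ∨
    ¬ ClockFull (β w) ∧ β w (.var Y)

/-- After `t` rounds of the phase number `n` the clock shows `t`, the variables have their values of
round `n` of the system, and the bits of the subschemata of modal depth less than `t` are
correct. -/
structure InPhase (n t : ℕ) (β : W → S.StateBit → Prop) : Prop where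
  clock w i : β w (.clock i) ↔ i < t
  var w Y : β w (.var Y) ↔ S.stage M n w Y
  sub w (φ : S.subschemata) :
    φ.1.modalDepth < t → (β w (.sub φ) ↔ φ.1.Holds M (S.stage M n) w)

section Phase

variable {S M} {n t : ℕ} {β : W → S.StateBit → Prop}

theorem InPhase.clockFull_iff (h : S.InPhase M n t β) (ht : t ≤ S.modalDepth) (w : W) :
    ClockFull (β w) ↔ t = S.modalDepth := by
  simp only [ClockFull, h.clock w]
  refine ⟨fun ht' => ht.antisymm (le_of_not_gt fun hlt => ?_), fun e i => e ▸ i.2⟩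
  exact lt_irrefl t (ht' ⟨t, hlt⟩)

theorem InPhase.sub_iff_of_isRound (h : S.InPhase M n t β) {w : W} {σ : S.StateBit → Prop}
    (hσ : S.IsRound M β w σ) (φ : Schema Sig T) (hφ : φ ∈ S.subschemata)
    (hd : φ.modalDepth ≤ t) : σ (.sub ⟨φ, hφ⟩) ↔ φ.Holds M (S.stage M n) w := by
  induction φ with
  | top => exact iff_of_true (hσ.sub_top hφ) trivial
  | prop p => exact hσ.sub_prop p hφ
  | var X => exact (hσ.sub_var X hφ).trans (h.var w X)
  | neg φ ih => exact (hσ.sub_neg φ hφ).trans (not_congr (ih _ hd))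
  | conj φ ψ ihφ ihψ =>
    exact (hσ.sub_conj φ ψ hφ).trans
      (and_congr (ihφ _ ((le_max_left _ _).trans hd)) (ihψ _ ((le_max_right _ _).trans hd)))
  | dia φ =>
    exact (hσ.sub_dia φ hφ).trans
      (exists_congr fun v => and_congr_right fun _ => h.sub v ⟨φ, _⟩ hd)

variable {β' : W → S.StateBit → Prop}

theorem InPhase.succ (h : S.InPhase M n t β) (ht : t < S.modalDepth)
    (hβ : ∀ w, S.IsRound M β w (β' w)) : S.InPhase M n (t + 1) β' := by
  have not_full (w : W) : ¬ ClockFull (β w) := fun hw => ht.ne ((h.clockFull_iff ht.le w).1 hw)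
  refine ⟨fun w i => ?_, fun w Y => ?_, fun w φ hφ => ?_⟩
  · simp only [(hβ w).clock, not_full, h.clock, not_false_eq_true, true_and, Nat.lt_succ_iff]
    refine ⟨fun hi => le_of_not_gt fun hlt => ?_, fun hi j hj => (Fin.lt_def.1 hj).trans_le hi⟩
    exact lt_irrefl t (hi ⟨t, ht⟩ hlt)
  · simp only [(hβ w).var, not_full, h.var, false_and, not_false_eq_true, true_and, false_or]
  · exact h.sub_iff_of_isRound (hβ w) φ φ.2 (Nat.le_of_lt_succ hφ)

theorem InPhase.next (h : S.InPhase M n S.modalDepth β) (hβ : ∀ w, S.IsRound M β w (β' w)) :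
    S.InPhase M (n + 1) 0 β' := by
  have full (w : W) : ClockFull (β w) := (h.clockFull_iff le_rfl w).2 rfl
  refine ⟨fun w i => ?_, fun w Y => ?_, fun _ _ hφ => absurd hφ (Nat.not_lt_zero _)⟩
  · simp only [(hβ w).clock, full, not_true_eq_false, false_and, Nat.not_lt_zero]
  · simp only [(hβ w).var, full, true_and, not_true_eq_false, false_and, or_false]
    exact h.sub_iff_of_isRound (hβ w) (S Y) _ (S.modalDepth_apply_le Y)

theorem inPhase_of_isRound {β : ℕ → W → S.StateBit → Prop} (h0 : ∀ w b, ¬ β 0 w b)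
    (hβ : ∀ q w, S.IsRound M (β q) w (β (q + 1) w)) (n : ℕ) {t : ℕ} (ht : t ≤ S.modalDepth) :
    S.InPhase M n t (β ((S.modalDepth + 1) * n + t)) := by
  induction n generalizing t with
  | zero =>
    induction t with
    | zero =>
      exact ⟨fun w i => iff_of_false (h0 w _) (Nat.not_lt_zero _),
        fun w Y => iff_of_false (h0 w _) id, fun _ _ hφ => absurd hφ (Nat.not_lt_zero _)⟩
    | succ t ih => exact (ih (Nat.le_of_succ_le ht)).succ ht (hβ _)
  | succ n ihn =>
    induction t with
    | zero => exact (ihn le_rfl).next (hβ _)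
    | succ t ih => exact (ih (Nat.le_of_succ_le ht)).succ ht (hβ _)

end Phase

section Circuit

variable {S M} [LinearOrder T] [Nonempty T] {Δ : ℕ}

theorem isRound_val {β : W → S.StateBit → Prop} {w : W}
    {x : Sig ⊕ (Fin (Δ + 1) × Fin S.stateLength) → Bool}
    (hprop : ∀ p, x (.inl p) = true ↔ w ∈ M.val p)
    (hown : ∀ b, x (.inr (0, S.bitEquiv b)) = true ↔ β w b)
    (hneighbour : ∀ b, (∃ j : Fin Δ, x (.inr (j.succ, S.bitEquiv b)) = true) ↔
      ∃ v, M.rel w v ∧ β v b) :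
    S.IsRound M β w fun b => (S.netlist Δ).Val x (.inr (.bit b)) := by
  have val_gate (g : S.Gate) : (S.netlist Δ).Val x (.inr g) ↔
      (S.gateDesc Δ g).Holds ((S.netlist Δ).Val x) := (S.netlist Δ).val_inr x g
  have val_prop (p : Sig) : (S.netlist Δ).Val x (.inl (.inl p)) ↔ w ∈ M.val p :=
    ((S.netlist Δ).val_inl x _).trans (hprop p)
  have val_ownWire (b : S.StateBit) : (S.netlist Δ).Val x (S.ownWire Δ b) ↔ β w b :=
    ((S.netlist Δ).val_inl x _).trans (hown b)
  have val_neighbourWire (b : S.StateBit) :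
      (∃ j, (S.netlist Δ).Val x (S.neighbourWire Δ j b)) ↔ ∃ v, M.rel w v ∧ β v b :=
    (exists_congr fun _ => (S.netlist Δ).val_inl x _).trans (hneighbour b)
  have val_tick : (S.netlist Δ).Val x (.inr .tick) ↔ ClockFull (β w) := by
    simp [val_gate, gateDesc, GateDesc.Holds, val_ownWire, ClockFull]
  have val_notTick : (S.netlist Δ).Val x (.inr .notTick) ↔ ¬ ClockFull (β w) := by
    rw [val_gate, ← val_tick]
    rfl
  constructor
  case sub_top | sub_prop | sub_var | sub_neg | sub_conj | sub_dia =>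
    intros
    rw [val_gate]
    simp [gateDesc, subDesc, GateDesc.Holds, val_prop, val_ownWire, val_neighbourWire]
  case clock =>
    intro i
    rw [val_gate]
    simp [gateDesc, GateDesc.Holds, val_ownWire, val_notTick]
  case var =>
    intro Y
    rw [val_gate]
    simp [gateDesc, GateDesc.Holds, val_gate (.update Y), val_gate (.keep Y), val_ownWire,
      val_tick, val_notTick]

variable (S M Δ) [LinearOrder PROP] (D : Set PROP) (attn print : Finset T)

/-- The bit `b` of the state of the node `w` before round `q` of the simulating circuit is on. -/
def BitAt (q : ℕ) (w : W) (b : S.StateBit) : Prop :=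
  (S.toMPC Δ attn print).state M D q w (S.bitEquiv b) = true

variable {S M Δ D}

theorem isRound_bitAt (hM : M.InClass D Δ) (q : ℕ) (w : W) :
    S.IsRound M (S.BitAt M Δ D attn print q) w (S.BitAt M Δ D attn print (q + 1) w) := by
  let x : Sig ⊕ (Fin (Δ + 1) × Fin S.stateLength) → Bool := Sum.elim (M.localInput w) fun jb =>
    (S.toMPC Δ attn print).received M D ((S.toMPC Δ attn print).state M D q) w jb.1 jb.2
  have bitAt_succ : S.BitAt M Δ D attn print (q + 1) w =
      fun b => (S.netlist Δ).Val x (.inr (.bit b)) := by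
    funext b
    rw [BitAt, MPC.state_succ]
    refine ((S.netlist Δ).run_toCircuit_iff x (S.bitEquiv b)).eq.trans ?_
    simp only [netlist, Equiv.symm_apply_apply]
  rw [bitAt_succ]
  exact isRound_val (fun _ => @decide_eq_true_iff _ (_)) (fun _ => Iff.rfl)
    fun b => (S.toMPC Δ attn print).exists_received_succ_iff hM _ w (S.bitEquiv b)

theorem bitAt_var_iff (hM : M.InClass D Δ) (q : ℕ) (w : W) (Y : T) :
    S.BitAt M Δ D attn print q w (.var Y) ↔ S.stage M (q / (S.modalDepth + 1)) w Y := by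
  have inPhase := inPhase_of_isRound (fun _ _ => Bool.false_ne_true)
    (isRound_bitAt attn print hM) (q / (S.modalDepth + 1))
    (Nat.le_of_lt_succ (Nat.mod_lt q S.modalDepth.succ_pos))
  rw [Nat.succ_eq_add_one, Nat.div_add_mod] at inPhase
  exact inPhase.var w Y

open Classical in
theorem outputs_toMPC_iff (hM : M.InClass D Δ) (w : W) (r : ℕ) (s : List Bool) :
    (S.toMPC Δ attn print).Outputs M D w r s ↔ ∃ n, r + 1 = (n + 1) * (S.modalDepth + 1) ∧
      OutputsInRound (fun n Y => decide (S.stage M (n + 1) w Y)) attn print n s := by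
  have config_eq (t : ℕ) (Y : T) : (S.toMPC Δ attn print).config M D t w (S.varEmbedding Y) =
      decide (S.stage M ((t + 1) / (S.modalDepth + 1)) w Y) :=
    Bool.eq_iff_iff.2 ((bitAt_var_iff attn print hM (t + 1) w Y).trans decide_eq_true_iff.symm)
  rw [← outputsInRound_div_iff (G := fun n Y => decide (S.stage M n w Y))
    (fun Y => decide_eq_false id) S.modalDepth.succ_pos]
  simp only [Nat.succ_eq_add_one, ← config_eq]
  exact outputsInRound_map_iff S.varEmbedding

end Circuit

end System

/-! ### Programs as systems -/

namespace Program

variable {PROP VAR : Type} {Sig : Finset PROP} (Λ : Program VAR Sig)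

/-- A program as a system. The variable `⊥` is true from round `1` on, so that the head predicates
take the values of the terminal clauses in round `1` and those of the iteration clauses later. -/
def toSystem : System Sig (WithBot Λ.heads)
  | ⊥ => .top
  | (Y : Λ.heads) => .ite (.var ⊥) ((Λ.iteration Y).map (↑)) ((Λ.terminal Y).map Empty.elim)

theorem stage_toSystem_bot {W : Type} (M : KripkeModel Sig W) (n : ℕ) (w : W) :
    Λ.toSystem.stage M n w ⊥ ↔ n ≠ 0 := by
  cases n with
  | zero => exact iff_of_false id fun h => h rfl
  | succ n => exact iff_of_true trivial n.succ_ne_zero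

theorem stage_toSystem_coe {W : Type} (M : KripkeModel Sig W) (n : ℕ) (w : W) (Y : Λ.heads) :
    Λ.toSystem.stage M (n + 1) w Y ↔ M.Sat w (Λ.iter n Y) := by
  induction n generalizing w Y with
  | zero =>
    refine (Schema.holds_ite M _ _ _ _ w).trans ?_
    simp [Schema.Holds, stage_toSystem_bot, Schema.holds_map, Schema.holds_iff_sat, iter]
  | succ n ih =>
    refine (Schema.holds_ite M _ _ _ _ w).trans ?_
    simp [Schema.Holds, stage_toSystem_bot, Schema.holds_map, ih, iter, Schema.sat_subst]

theorem length_pos : 0 < Λ.length :=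
  Finset.sum_pos (fun _ _ => Nat.succ_pos _)
    (Finset.univ_nonempty_iff.2 Λ.heads_nonempty.coe_sort)

theorem length_toSystem_coe (Y : Λ.heads) :
    (Λ.toSystem Y).length = (Λ.iteration Y).length + (Λ.terminal Y).length + 10 := by
  simp only [toSystem, Schema.ite, Schema.length, Schema.length_map]
  omega

theorem length_toSystem_le : Λ.toSystem.length ≤ 4 * Λ.length := by
  have length_eq : Λ.toSystem.length = 1 + ∑ Y : Λ.heads, (Λ.toSystem Y).length :=
    Fintype.sum_option _
  have sum_le : ∑ Y : Λ.heads, (Λ.toSystem Y).length ≤ 3 * Λ.length := by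
    rw [length, Finset.mul_sum]
    refine Finset.sum_le_sum fun Y _ => ?_
    have := (Λ.iteration Y).length_pos
    have := (Λ.terminal Y).length_pos
    rw [length_toSystem_coe]
    omega
  have := Λ.length_pos
  omega

theorem modalDepth_toSystem_le : Λ.toSystem.modalDepth ≤ Λ.modalDepth := by
  refine Finset.sup_le fun Y _ => ?_
  cases Y with
  | bot => exact Nat.zero_le _
  | coe Y =>
    refine le_of_eq_of_le ?_ (Finset.le_sup
      (f := fun Y => max (Λ.terminal Y).modalDepth (Λ.iteration Y).modalDepth) (Finset.mem_univ Y))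
    simp [toSystem, Schema.ite, Schema.modalDepth, Schema.modalDepth_map, max_comm]

section Circuit

variable [LinearOrder VAR] (Δ : ℕ)

/-- The message passing circuit that simulates a program. -/
noncomputable def toMPC : MPC Sig Δ :=
  Λ.toSystem.toMPC Δ (Λ.attention.map WithBot.coeOrderHom.toEmbedding)
    (Λ.print.map WithBot.coeOrderHom.toEmbedding)

theorem size_toMPC_le : (Λ.toMPC Δ).size ≤ 64 * (max 1 Δ * Λ.length + Sig.card) := by
  have size_le : (Λ.toMPC Δ).size ≤ Sig.card + 3 * (Δ + 4) * Λ.toSystem.length + 4 :=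
    Λ.toSystem.size_toMPC_le Δ _ _
  have length_le : 3 * (Δ + 4) * Λ.toSystem.length ≤ 3 * (5 * max 1 Δ) * (4 * Λ.length) :=
    Nat.mul_le_mul (by omega) Λ.length_toSystem_le
  have := Nat.mul_pos (lt_max_of_lt_left one_pos : 0 < max 1 Δ) Λ.length_pos
  linarith

variable [LinearOrder PROP] {Λ Δ} {D : Set PROP} {W : Type} {M : KripkeModel Sig W}

theorem outputs_toMPC_iff (hM : M.InClass D Δ) (w : W) (r : ℕ) (s : List Bool) :
    (Λ.toMPC Δ).Outputs M D w r s ↔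
      ∃ n, r + 1 = (n + 1) * (Λ.toSystem.modalDepth + 1) ∧ Λ.Outputs M w n s := by
  classical
  refine (Λ.toSystem.outputs_toMPC_iff _ _ hM w r s).trans
    (exists_congr fun n => and_congr_right fun _ => ?_)
  rw [outputsInRound_map_iff]
  simp only [WithBot.coeOrderHom_apply, stage_toSystem_coe]
  rfl

theorem equivalent_toMPC : Equivalent D Λ (Λ.toMPC Δ) := by
  refine fun W M hM w s => ⟨fun ⟨n, hn⟩ => ?_, fun ⟨r, hr⟩ => ?_⟩
  · obtain ⟨r, hr⟩ := Nat.exists_eq_add_one.2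
      (Nat.mul_pos n.succ_pos Λ.toSystem.modalDepth.succ_pos)
    exact ⟨r, (outputs_toMPC_iff hM w r s).2 ⟨n, hr.symm, hn⟩⟩
  · obtain ⟨n, -, hn⟩ := (outputs_toMPC_iff hM w r s).1 hr
    exact ⟨n, hn⟩

theorem timeFactorAtMost_toMPC :
    TimeFactorAtMost D Λ (Λ.toMPC Δ) (2 * max 1 Λ.modalDepth) := by
  intro W M hM w n r s s' hn hr
  obtain ⟨n', hr', hn'⟩ := (outputs_toMPC_iff hM w r s').1 hr
  obtain rfl : n = n' := hn.1.unique hn'.1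
  have phase_le : Λ.toSystem.modalDepth + 1 ≤ 2 * max 1 Λ.modalDepth := by
    have := Λ.modalDepth_toSystem_le
    omega
  rw [hr', mul_comm]
  exact Nat.mul_le_mul_right _ phase_le

end Circuit

end Program

end MSC

theorem mainTheorem2 :
    ∃ c₁ c₂ : ℕ, ∀ (PROP VAR : Type) [LinearOrder PROP] [LinearOrder VAR]
      (D : Set PROP) (Sig : Finset PROP) (Δ : ℕ) (Λ : MSC.Program VAR Sig),
      ∃ C : MSC.MPC Sig Δ,
        MSC.Equivalent D Λ C ∧
        C.size ≤ c₁ * (max 1 Δ * Λ.length + Sig.card) ∧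
        MSC.TimeFactorAtMost D Λ C (c₂ * max 1 Λ.modalDepth) :=
  ⟨64, 2, fun _ _ _ _ _ _ Δ Λ =>
    ⟨Λ.toMPC Δ, Λ.equivalent_toMPC, Λ.size_toMPC_le Δ, Λ.timeFactorAtMost_toMPC⟩⟩
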